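/- Let $1\le d'<d$, let $D$ be a probability distribution on $\mathbb{R}^d$ and let $B$ be such that $\|x\|^2\le B$ for ($D$-almost) every $x$. Let $\mathbf{C}$ be the covariance matrix of $D$, let $\lambda_1\ge\lambda_2\ge\dots\ge\lambda_d\ge 0$ be its eigenvalues, and assume $\lambda_1>\lambda_2>\dots>\lambda_{d'}>\lambda_{d'+1}$. Let $0<\delta\le 1$, let $$n\ \ge\ \left(\frac{4B}{\lambda_{d'}-\lambda_{d'+1}}\left(1+\sqrt{\frac{\ln(1/\delta)}{2}}\right)\right)^2 ,$$ let $x_1,\dots,x_n$ be drawn i.i.d. from $D$, with mean $\bar x=\frac1n\sum_k x_k$, and let $\tilde{\mathbf{C}}=\frac1{n-1}\sum_{k}(x_k-\bar x)(x_k-\bar x)^T$ be their sample covariance matrix. Let $\mathbf{U}^{d'}_{\mathbf{C}}$ and $\mathbf{U}^{d'}_{\tilde{\mathbf{C}}}$ be $d\times d'$ matrices whose columns are orthonormal eigenvectors of $\mathbf{C}$ and of $\tilde{\mathbf{C}}$, respectively, for their $d'$ largest eigenvalues (counted with multiplicity), and put $$E(\delta)=\frac{4B}{\sqrt n}\left(1+\sqrt{\frac{\ln(1/\delta)}{2}}\right).$$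 Then, with probability at least $1-\delta$, for every such choice of eigenvectors, $$\left\|\mathbf{U}^{d'}_{\mathbf{C}}\mathbf{U}^{d'\,T}_{\mathbf{C}}-\mathbf{U}^{d'}_{\tilde{\mathbf{C}}}\mathbf{U}^{d'\,T}_{\tilde{\mathbf{C}}}\right\|_F\ \le\ 2\sqrt2\,E(\delta)\,\frac{\sqrt{d'}}{\lambda_{d'}-\lambda_{d'+1}},$$ where $\|\cdot\|_F$ is the Frobenius norm. -/

import Mathlib

open MeasureTheory ProbabilityTheory
open scoped Matrix Matrix.Norms.Frobenius

noncomputable section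

/-- The covariance matrix of a distribution `D` on `ℝ^d`: its `(i, j)` entry is the covariance
of the `i`-th and the `j`-th coordinate. -/
def covMatrix {d : ℕ} (D : Measure (EuclideanSpace ℝ (Fin d))) : Matrix (Fin d) (Fin d) ℝ :=
  Matrix.of fun i j => covariance (fun x => x i) (fun x => x j) D

/-- The data matrix of a sample `x₁, …, xₙ` in `ℝ^d` with its mean subtracted from every column:
`X - x̄ 1ᵀ`, where `X` has the columns `x₁, …, xₙ` and `x̄ = (1/n) ∑ x_k`. -/
def centeredData {d n : ℕ} (x : Fin n → EuclideanSpace ℝ (Fin d)) : Matrix (Fin d) (Fin n) ℝ :=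
  Matrix.of fun i k => x k i - (1 / (n : ℝ)) * ∑ l, x l i

/-- The sample covariance matrix `(1/(n-1)) (X - x̄ 1ᵀ) (X - x̄ 1ᵀ)ᵀ`. -/
def sampleCovMatrix {d n : ℕ} (x : Fin n → EuclideanSpace ℝ (Fin d)) :
    Matrix (Fin d) (Fin d) ℝ :=
  (1 / ((n : ℝ) - 1)) • (centeredData x * (centeredData x)ᵀ)

/-- `lam 0 ≥ lam 1 ≥ …` are the eigenvalues of `M`, with multiplicity, in decreasing order, and
the columns of `V` are corresponding orthonormal eigenvectors. -/
structure IsOrderedEigensystem {d : ℕ} (M : Matrix (Fin d) (Fin d) ℝ) (lam : Fin d → ℝ)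
    (V : Matrix (Fin d) (Fin d) ℝ) : Prop where
  antitone : Antitone lam
  orthonormal : Vᵀ * V = 1
  eigen : M * V = V * Matrix.diagonal lam

/-- The matrix formed by the first `m` columns of `V`. -/
def firstCols {d m : ℕ} (h : m ≤ d) (V : Matrix (Fin d) (Fin d) ℝ) : Matrix (Fin d) (Fin m) ℝ :=
  V.submatrix id (Fin.castLE h)

/-- `E(δ) = (4 B / √n) (1 + √(ln (1/δ) / 2))`. -/
def errE (B : ℝ) (n : ℕ) (δ : ℝ) : ℝ :=
  4 * B / √(n : ℝ) * (1 + √(Real.log (1 / δ) / 2))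

end

/-!
The proof works with the Frobenius norm throughout. Let `P` and `Q` be the orthogonal projections
onto the leading `m`-dimensional eigenspaces of symmetric matrices `C` and `T`.

*Perturbation of eigenspaces.* Since `P` maximizes `tr (C R)` over rank `m` projections `R`, with
quadratic growth governed by the spectral gap, `gap * ‖P - Q‖² / 2 ≤ tr (C (P - Q))`, while
`0 ≤ tr (T (Q - P))` because `Q` is a maximizer for `T`. Adding the two and applying the
Cauchy-Schwarz inequality gives `‖P - Q‖ ≤ 2 ‖T - C‖ / gap`
(`IsOrderedEigensystem.frobenius_norm_sub_le`).

*Concentration.* It remains to see that `‖T - C‖ ≤ √2 E(δ)` with probability at least `1 - δ` when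
`T` is the sample covariance matrix. Replacing one sample point changes `T` by at most `4 √2 B / n`
(`norm_sampleCovMatrix_update_sub_le`), so McDiarmid's inequality, which follows by induction from
Hoeffding's lemma (`hasSubgaussianMGF_of_bounded_differences`), bounds the deviation of `‖T - C‖`
above its expectation by `4 √2 B √(ln (1/δ) / 2) / √n`. A second moment computation bounds the
expectation itself by `4 √2 B / √n` (`integral_norm_sampleCovMatrix_sub_le`).

The gap is at most `B`, because every eigenvalue of `C` is the variance of a one-dimensional
projection; the lower bound on the sample size therefore forces `n ≥ 16`, and in particular the
normalization `1 / (n - 1)` is a genuine one.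
-/

/-! ### McDiarmid's inequality -/

theorem abs_sub_le_of_bounded_differences {α : Type*} {c : ℝ} :
    ∀ {n : ℕ} {g : (Fin n → α) → ℝ}
      (_ : ∀ x k a, |g (Function.update x k a) - g x| ≤ c) (x y : Fin n → α),
      |g x - g y| ≤ n * c
  | 0, g, _, x, y => by simp [Subsingleton.elim x y]
  | n + 1, g, hg, x, y => by
    have h1 : |g (Fin.cons (x 0) (Fin.tail x)) - g (Fin.cons (x 0) (Fin.tail y))| ≤ n * c := by
      refine abs_sub_le_of_bounded_differences (g := fun u => g (Fin.cons (x 0) u))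
        (fun u k a => ?_) _ _
      have := hg (Fin.cons (x 0) u) k.succ a
      rwa [← Fin.cons_update] at this
    have h2 := hg (Fin.cons (y 0) (Fin.tail y)) 0 (x 0)
    rw [Fin.update_cons_zero] at h2
    rw [Fin.cons_self_tail] at h1 h2
    have := abs_sub_le (g x) (g (Fin.cons (x 0) (Fin.tail y))) (g y)
    push_cast
    linarith

/-- **Hoeffding's lemma** for a function whose values differ by at most `c`. -/
theorem hasSubgaussianMGF_of_abs_sub_le {α : Type*} [MeasurableSpace α] {μ : Measure α}
    [IsProbabilityMeasure μ] {f : α → ℝ} (hf : Measurable f) {c : NNReal}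
    (hc : ∀ a b, |f a - f b| ≤ c) :
    HasSubgaussianMGF (fun a => f a - ∫ b, f b ∂μ) ((c / 2) ^ 2) μ := by
  obtain ⟨a₀⟩ : Nonempty α := nonempty_of_isProbabilityMeasure μ
  have hbdd : BddBelow (Set.range f) := by
    refine ⟨f a₀ - c, ?_⟩
    rintro _ ⟨a, rfl⟩
    linarith [(abs_le.1 (hc a a₀)).1]
  have hmem : ∀ a, f a ∈ Set.Icc (⨅ b, f b) ((⨅ b, f b) + c) := fun a =>
    ⟨ciInf_le hbdd a, by
      have : f a - c ≤ ⨅ b, f b :=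
        haveI : Nonempty α := ⟨a₀⟩
        le_ciInf fun b => by linarith [(abs_le.1 (hc a b)).2]
      linarith⟩
  have := hasSubgaussianMGF_of_mem_Icc (μ := μ) hf.aemeasurable (ae_of_all _ hmem)
  simpa using this

/-- **McDiarmid's inequality**, in the form of a bound on the moment generating function: a function
of `n` i.i.d. variables that changes by at most `c` when a single argument is changed is
sub-Gaussian with the same parameter as a sum of `n` independent variables of range `c`. -/
theorem hasSubgaussianMGF_of_bounded_differences {α : Type*} [MeasurableSpace α] (μ : Measure α)
    [IsProbabilityMeasure μ] {c : NNReal} :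
    ∀ {n : ℕ} {g : (Fin n → α) → ℝ} (_ : Measurable g)
      (_ : ∀ x k a, |g (Function.update x k a) - g x| ≤ c),
      HasSubgaussianMGF (fun x => g x - ∫ y, g y ∂(Measure.pi fun _ => μ)) (n * (c / 2) ^ 2)
        (Measure.pi fun _ : Fin n => μ)
  | 0, g, _, _ => by
    have h : (fun x => g x - ∫ y, g y ∂(Measure.pi fun _ : Fin 0 => μ)) = fun _ => 0 := by
      ext x
      have : g = fun _ => g x := funext fun y => by rw [Subsingleton.elim y x]
      rw [this]
      simp
    rw [h]
    simp
  | n + 1, g, hm, hg => by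
    obtain ⟨a₀⟩ : Nonempty α := nonempty_of_isProbabilityMeasure μ
    have hosc := abs_sub_le_of_bounded_differences hg
    have hm' : Measurable fun p : α × (Fin n → α) => g (Fin.cons p.1 p.2) :=
      hm.comp (by
        refine measurable_pi_lambda _ fun i => ?_
        refine Fin.cases ?_ (fun j => ?_) i
        · simpa using measurable_fst
        · simp only [Fin.cons_succ]
          fun_prop)
    have hbd : ∀ x, |g x| ≤ |g fun _ => a₀| + (n + 1 : ℕ) * c := fun x => by
      have h1 := hosc x fun _ => a₀
      have h2 := abs_sub_abs_le_abs_sub (g x) (g fun _ => a₀)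
      linarith
    set K := |g fun _ => a₀| + (n + 1 : ℕ) * c
    have hintG : Integrable (fun p : α × (Fin n → α) => g (Fin.cons p.1 p.2))
        (μ.prod (Measure.pi fun _ => μ)) :=
      Integrable.of_bound hm'.aestronglyMeasurable K (ae_of_all _ fun p => hbd _)
    have hints : ∀ y : Fin n → α, Integrable (fun a => g (Fin.cons a y)) μ := fun y =>
      Integrable.of_bound (hm'.comp measurable_prodMk_right).aestronglyMeasurable K
        (ae_of_all _ fun p => hbd _)
    -- Averaging out the first coordinate keeps the bounded differences in the others, so the
    -- induction hypothesis applies to `h`; Hoeffding's lemma handles `g - h` for fixed `y`.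
    set h : (Fin n → α) → ℝ := fun y => ∫ a, g (Fin.cons a y) ∂μ with hh
    have hhm : Measurable h := hm'.stronglyMeasurable.integral_prod_left'.measurable
    have hhd : ∀ x k a, |h (Function.update x k a) - h x| ≤ c := fun x k a => by
      rw [hh]
      simp only
      rw [← integral_sub (hints _) (hints _)]
      have := norm_integral_le_of_norm_le_const (μ := μ) (C := (c : ℝ))
        (f := fun b => g (Fin.cons b (Function.update x k a)) - g (Fin.cons b x))
        (ae_of_all _ fun b => by
          rw [Fin.cons_update]
          exact hg _ _ _)
      simpa using this
    have ih := hasSubgaussianMGF_of_bounded_differences μ hhm hhd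
    have hmp := (measurePreserving_piFinSuccAbove (fun _ : Fin (n + 1) => μ) 0).symm
    have hsymm : ∀ p, (MeasurableEquiv.piFinSuccAbove (fun _ : Fin (n + 1) => α) 0).symm p
        = Fin.cons p.1 p.2 := fun p => by
      simp [MeasurableEquiv.piFinSuccAbove, Fin.insertNthEquiv]
    have hEg : ∫ y, g y ∂(Measure.pi fun _ : Fin (n + 1) => μ)
        = ∫ y, h y ∂(Measure.pi fun _ : Fin n => μ) := by
      rw [← hmp.integral_comp', hh, ← integral_prod_symm _ hintG]
      simp_rw [hsymm]
    have hexp : ∀ t x, ‖Real.exp (t * (g x - ∫ y, g y ∂(Measure.pi fun _ : Fin (n + 1) => μ)))‖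
        ≤ Real.exp (|t| * (K + |∫ y, g y ∂(Measure.pi fun _ : Fin (n + 1) => μ)|)) := by
      intro t x
      rw [Real.norm_eq_abs, Real.abs_exp]
      refine Real.exp_le_exp.2 ((le_abs_self _).trans ?_)
      rw [abs_mul]
      gcongr
      exact (abs_sub _ _).trans (by gcongr; exact hbd x)
    refine ⟨fun t => ?_, fun t => ?_⟩
    · exact Integrable.of_bound (by fun_prop) _ (ae_of_all _ (hexp t))
    · rw [mgf, ← hmp.integral_comp']
      simp_rw [hsymm]
      rw [integral_prod_symm _
        (Integrable.of_bound (((hm'.sub_const _).const_mul t).exp).aestronglyMeasurable _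
          (ae_of_all _ fun p => hexp t _)), hEg]
      have hsplit : ∀ y a, Real.exp (t * (g (Fin.cons a y) -
          ∫ y, h y ∂(Measure.pi fun _ : Fin n => μ)))
          = Real.exp (t * (g (Fin.cons a y) - h y)) *
            Real.exp (t * (h y - ∫ y, h y ∂(Measure.pi fun _ : Fin n => μ))) := fun y a => by
        rw [← Real.exp_add]
        ring_nf
      simp_rw [hsplit, integral_mul_const]
      have hinner : ∀ y, ∫ a, Real.exp (t * (g (Fin.cons a y) - h y)) ∂μ
          ≤ Real.exp (((c / 2) ^ 2 : NNReal) * t ^ 2 / 2) := fun y =>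
        (hasSubgaussianMGF_of_abs_sub_le (μ := μ) (f := fun a => g (Fin.cons a y))
          (hm'.comp measurable_prodMk_right) (c := c) (fun a b => by
            have := hg (Fin.cons b y) 0 a
            rwa [Fin.update_cons_zero] at this)).mgf_le t
      calc _ ≤ ∫ y, Real.exp (((c / 2) ^ 2 : NNReal) * t ^ 2 / 2) *
            Real.exp (t * (h y - ∫ y, h y ∂(Measure.pi fun _ : Fin n => μ)))
              ∂(Measure.pi fun _ : Fin n => μ) := by
            refine integral_mono_of_nonneg (ae_of_all _ fun y => ?_)
              ((ih.integrable_exp_mul t).const_mul _) (ae_of_all _ fun y => ?_)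
            · positivity
            · exact mul_le_mul_of_nonneg_right (hinner y) (Real.exp_nonneg _)
        _ ≤ Real.exp (((c / 2) ^ 2 : NNReal) * t ^ 2 / 2) *
              Real.exp ((n * (c / 2) ^ 2 : NNReal) * t ^ 2 / 2) := by
            rw [integral_const_mul]
            exact mul_le_mul_of_nonneg_left (ih.mgf_le t) (Real.exp_nonneg _)
        _ = _ := by
            rw [← Real.exp_add]
            push_cast
            ring_nf

/-! ### The Frobenius norm and its inner product -/

theorem frobenius_norm_sq {m n : Type*} [Fintype m] [Fintype n] (A : Matrix m n ℝ) :
    ‖A‖ ^ 2 = ∑ i, ∑ j, A i j ^ 2 := by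
  rw [Matrix.frobenius_norm_def, ← Real.sqrt_eq_rpow, Real.sq_sqrt]
  · simp
  · positivity

theorem frobenius_norm_eq_sqrt {m n : Type*} [Fintype m] [Fintype n] (A : Matrix m n ℝ) :
    ‖A‖ = √(∑ i, ∑ j, A i j ^ 2) := by
  rw [← frobenius_norm_sq, Real.sqrt_sq (norm_nonneg _)]

theorem frobenius_norm_sq_eq_trace {m n : Type*} [Fintype m] [Fintype n] (A : Matrix m n ℝ) :
    ‖A‖ ^ 2 = (Aᵀ * A).trace := by
  rw [frobenius_norm_sq, Finset.sum_comm]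
  simp [Matrix.trace, Matrix.mul_apply, sq]

theorem trace_transpose_mul_le {m n : Type*} [Fintype m] [Fintype n] (A B : Matrix m n ℝ) :
    (Aᵀ * B).trace ≤ ‖A‖ * ‖B‖ := by
  have h := Finset.sum_mul_sq_le_sq_mul_sq Finset.univ (fun p : m × n => A p.1 p.2)
    (fun p => B p.1 p.2)
  simp only [Fintype.sum_prod_type, ← frobenius_norm_sq] at h
  have htr : (Aᵀ * B).trace = ∑ i, ∑ j, A i j * B i j := by
    rw [Finset.sum_comm]
    simp [Matrix.trace, Matrix.mul_apply]
  rw [htr]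
  rw [← mul_pow] at h
  exact le_of_sq_le_sq h (by positivity)

/-! ### Perturbation of leading eigenspaces -/

section spectral

variable {d m : ℕ}

theorem firstCols_transpose_mul_self (h : m ≤ d) {V : Matrix (Fin d) (Fin d) ℝ}
    (hV : Vᵀ * V = 1) : (firstCols h V)ᵀ * firstCols h V = 1 := by
  ext i j
  have := congrFun (congrFun hV (Fin.castLE h i)) (Fin.castLE h j)
  simpa [Matrix.mul_apply, firstCols, Matrix.one_apply] using this

theorem sum_ite_val_lt (h : m ≤ d) (F : Fin d → ℝ) :
    ∑ i : Fin d, (if (i : ℕ) < m then F i else 0) = ∑ k, F (Fin.castLE h k) := by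
  obtain ⟨r, rfl⟩ := Nat.exists_eq_add_of_le h
  rw [Fin.sum_univ_add]
  simp
  rfl

theorem frobenius_norm_sub_sq_of_orthonormal {U W : Matrix (Fin d) (Fin m) ℝ}
    (hU : Uᵀ * U = 1) (hW : Wᵀ * W = 1) :
    ‖U * Uᵀ - W * Wᵀ‖ ^ 2 = 2 * (m - (U * Uᵀ * (W * Wᵀ)).trace) := by
  have hP : U * Uᵀ * (U * Uᵀ) = U * Uᵀ := by
    rw [Matrix.mul_assoc, ← Matrix.mul_assoc Uᵀ, hU, Matrix.one_mul]
  have hQ : W * Wᵀ * (W * Wᵀ) = W * Wᵀ := by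
    rw [Matrix.mul_assoc, ← Matrix.mul_assoc Wᵀ, hW, Matrix.one_mul]
  have htP : (U * Uᵀ).trace = m := by rw [Matrix.trace_mul_comm, hU]; simp
  have htQ : (W * Wᵀ).trace = m := by rw [Matrix.trace_mul_comm, hW]; simp
  have hs : (U * Uᵀ - W * Wᵀ)ᵀ = U * Uᵀ - W * Wᵀ := by
    simp [Matrix.transpose_sub, Matrix.transpose_mul]
  rw [frobenius_norm_sq_eq_trace, hs, Matrix.sub_mul, Matrix.mul_sub, Matrix.mul_sub, hP, hQ,
    Matrix.trace_sub, Matrix.trace_sub, Matrix.trace_sub, htP, htQ,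
    Matrix.trace_mul_comm (W * Wᵀ)]
  ring

/-- The diagonal entries of an orthogonal projection are at most `1`. -/
theorem sum_sq_row_le_one {W : Matrix (Fin d) (Fin m) ℝ} (hW : Wᵀ * W = 1) (i : Fin d) :
    ∑ j, W i j ^ 2 ≤ 1 := by
  have hidem : W * Wᵀ * (W * Wᵀ) = W * Wᵀ := by
    rw [Matrix.mul_assoc, ← Matrix.mul_assoc Wᵀ, hW, Matrix.one_mul]
  have hq : (W * Wᵀ) i i = ∑ j, W i j ^ 2 := by simp [Matrix.mul_apply, sq]
  have hsym : ∀ k, (W * Wᵀ) k i = (W * Wᵀ) i k := fun k => by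
    simp [Matrix.mul_apply, mul_comm]
  have h1 : ∑ k, (W * Wᵀ) i k ^ 2 = (W * Wᵀ) i i := by
    conv_rhs => rw [← hidem, Matrix.mul_apply]
    simp only [hsym, sq]
  have h2 : (W * Wᵀ) i i ^ 2 ≤ (W * Wᵀ) i i := by
    conv_rhs => rw [← h1]
    exact Finset.single_le_sum (f := fun k => (W * Wᵀ) i k ^ 2) (fun k _ => sq_nonneg _)
      (Finset.mem_univ i)
  rw [← hq]
  nlinarith

/-- Ky Fan's maximum principle with quadratic growth: among the projections `W * Wᵀ` of rank `m`,
the trace of `M * (W * Wᵀ)` is largest for the leading eigenvectors of `M`, and it falls short of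
the maximum by at least the spectral gap times half the squared distance to the maximizer (see
`frobenius_norm_sub_sq_of_orthonormal`). -/
theorem IsOrderedEigensystem.gap_mul_le_trace {M V : Matrix (Fin d) (Fin d) ℝ} {lam : Fin d → ℝ}
    (hM : IsOrderedEigensystem M lam V) (hmd : m ≤ d)
    {k l : Fin d} (hk : (k : ℕ) + 1 = m) (hl : (l : ℕ) = m)
    {W : Matrix (Fin d) (Fin m) ℝ} (hW : Wᵀ * W = 1) :
    (lam k - lam l) *
        (m - (firstCols hmd V * (firstCols hmd V)ᵀ * (W * Wᵀ)).trace)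
      ≤ (M * (firstCols hmd V * (firstCols hmd V)ᵀ - W * Wᵀ)).trace := by
  set U := firstCols hmd V with hUdef
  have hVV : V * Vᵀ = 1 := mul_eq_one_comm.1 hM.orthonormal
  have hMV : M = V * Matrix.diagonal lam * Vᵀ := by
    rw [← hM.eigen, Matrix.mul_assoc, hVV, Matrix.mul_one]
  -- In the eigenbasis both traces are weighted sums of the eigenvalues: `q i` is the squared length
  -- of the projection of the `i`-th eigenvector to the range of `W`, and `p i` is its analogue
  -- for `U`.
  set Y := Vᵀ * W with hY
  have hYY : Yᵀ * Y = 1 := by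
    rw [hY, Matrix.transpose_mul, Matrix.transpose_transpose, Matrix.mul_assoc,
      ← Matrix.mul_assoc V, hVV, Matrix.one_mul, hW]
  set q : Fin d → ℝ := fun i => ∑ j, Y i j ^ 2 with hq
  have hq1 : ∀ i, q i ≤ 1 := sum_sq_row_le_one hYY
  have hq0 : ∀ i, 0 ≤ q i := fun i => Finset.sum_nonneg fun j _ => sq_nonneg _
  have hqsum : ∑ i, q i = m := by
    rw [hq, ← frobenius_norm_sq, frobenius_norm_sq_eq_trace, hYY]
    simp
  set p : Fin d → ℝ := fun i => if (i : ℕ) < m then 1 else 0 with hp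
  have hUp : U * Uᵀ = V * Matrix.diagonal p * Vᵀ := by
    ext a b
    rw [Matrix.mul_apply, Matrix.mul_apply]
    simp only [Matrix.mul_diagonal, Matrix.transpose_apply, hUdef, firstCols,
      Matrix.submatrix_apply, id, hp]
    rw [← sum_ite_val_lt hmd fun i => V a i * V b i]
    refine Finset.sum_congr rfl fun i _ => ?_
    split_ifs <;> simp
  have htrW : ∀ e : Fin d → ℝ,
      (V * Matrix.diagonal e * Vᵀ * (W * Wᵀ)).trace = ∑ i, e i * q i := by
    intro e
    have : V * Matrix.diagonal e * Vᵀ * (W * Wᵀ) = V * (Matrix.diagonal e * (Y * Wᵀ)) := by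
      simp only [hY, Matrix.mul_assoc]
    rw [this, Matrix.trace_mul_comm]
    have : Matrix.diagonal e * (Y * Wᵀ) * V = Matrix.diagonal e * (Y * Yᵀ) := by
      simp only [hY, Matrix.transpose_mul, Matrix.transpose_transpose, Matrix.mul_assoc]
    rw [this]
    simp only [Matrix.trace, Matrix.diag_apply, Matrix.diagonal_mul]
    refine Finset.sum_congr rfl fun i _ => ?_
    simp [hq, Matrix.mul_apply, sq]
  have htrU : (M * (U * Uᵀ)).trace = ∑ i, lam i * p i := by
    have : M * (U * Uᵀ) = V * (Matrix.diagonal lam * Matrix.diagonal p * Vᵀ) := by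
      rw [hMV, hUp]
      calc _ = V * (Matrix.diagonal lam * ((Vᵀ * V) * (Matrix.diagonal p * Vᵀ))) := by
            simp only [Matrix.mul_assoc]
        _ = _ := by rw [hM.orthonormal, Matrix.one_mul, Matrix.mul_assoc]
    rw [this, Matrix.trace_mul_comm, Matrix.mul_assoc, hM.orthonormal, Matrix.mul_one,
      Matrix.diagonal_mul_diagonal, Matrix.trace_diagonal]
  have hpsum : ∑ i, p i = m := by
    rw [hp, sum_ite_val_lt hmd fun _ => (1 : ℝ)]
    simp
  set a := lam k
  set b := lam l
  rw [Matrix.mul_sub, Matrix.trace_sub, htrU, hUp, htrW]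
  conv_rhs => rw [hMV, htrW]
  -- For `i < m` use `a ≤ lam i` and `q i ≤ 1`, for the others `lam i ≤ b` and `0 ≤ q i`; the terms
  -- with the factor `b` cancel in the sum, as `p` and `q` have the same total `m`.
  have key : ∀ i, (a - b) * (p i - p i * q i) + b * (p i - q i) ≤ lam i * p i - lam i * q i := by
    intro i
    by_cases hi : (i : ℕ) < m
    · have h1 : a ≤ lam i := hM.antitone (by rw [Fin.le_def]; omega)
      simp only [hp, hi, if_true]
      nlinarith [hq1 i]
    · have h1 : lam i ≤ b := hM.antitone (by rw [Fin.le_def]; omega)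
      simp only [hp, hi, if_false]
      nlinarith [hq0 i]
  have hs := Finset.sum_le_sum fun i (_ : i ∈ Finset.univ) => key i
  rw [Finset.sum_add_distrib, ← Finset.mul_sum, ← Finset.mul_sum, Finset.sum_sub_distrib,
    Finset.sum_sub_distrib, Finset.sum_sub_distrib, hpsum, hqsum, sub_self, mul_zero,
    add_zero] at hs
  exact hs

/-- A Frobenius norm version of the **Davis-Kahan theorem**. Only `M` needs a spectral gap. -/
theorem IsOrderedEigensystem.frobenius_norm_sub_le {M M' V V' : Matrix (Fin d) (Fin d) ℝ}
    {lam lam' : Fin d → ℝ}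
    (hM : IsOrderedEigensystem M lam V) (hM' : IsOrderedEigensystem M' lam' V')
    (hmd : m ≤ d) {k l : Fin d} (hk : (k : ℕ) + 1 = m) (hl : (l : ℕ) = m) (hgap : lam l < lam k) :
    ‖firstCols hmd V * (firstCols hmd V)ᵀ - firstCols hmd V' * (firstCols hmd V')ᵀ‖
      ≤ 2 * ‖M' - M‖ / (lam k - lam l) := by
  have hU := firstCols_transpose_mul_self hmd hM.orthonormal
  have hW := firstCols_transpose_mul_self hmd hM'.orthonormal
  set U := firstCols hmd V
  set W := firstCols hmd V'
  have hsq := frobenius_norm_sub_sq_of_orthonormal hU hW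
  have h1 := hM.gap_mul_le_trace hmd hk hl hW
  have h2 := hM'.gap_mul_le_trace hmd hk hl hU
  change _ ≤ (M' * (W * Wᵀ - U * Uᵀ)).trace at h2
  rw [Matrix.trace_mul_comm (W * Wᵀ) (U * Uᵀ)] at h2
  have hnn : 0 ≤ (m : ℝ) - (U * Uᵀ * (W * Wᵀ)).trace := by
    nlinarith [sq_nonneg ‖U * Uᵀ - W * Wᵀ‖]
  have h3 : 0 ≤ (M' * (W * Wᵀ - U * Uᵀ)).trace :=
    (mul_nonneg (sub_nonneg.2 (hM'.antitone (by rw [Fin.le_def]; omega))) hnn).trans h2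
  have h4 : (M * (U * Uᵀ - W * Wᵀ)).trace + (M' * (W * Wᵀ - U * Uᵀ)).trace
      = ((U * Uᵀ - W * Wᵀ)ᵀ * (M - M')).trace := by
    have hs : (U * Uᵀ - W * Wᵀ)ᵀ = U * Uᵀ - W * Wᵀ := by
      simp [Matrix.transpose_sub, Matrix.transpose_mul]
    rw [hs, Matrix.trace_mul_comm (U * Uᵀ - W * Wᵀ), ← neg_sub (U * Uᵀ) (W * Wᵀ),
      Matrix.mul_neg, Matrix.sub_mul, Matrix.trace_sub, Matrix.trace_neg]
    ring
  have h5 := trace_transpose_mul_le (U * Uᵀ - W * Wᵀ) (M - M')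
  rw [norm_sub_rev M M'] at h5
  have hg : 0 < lam k - lam l := sub_pos.2 hgap
  set x := ‖U * Uᵀ - W * Wᵀ‖
  set D := ‖M' - M‖
  have hx : 0 ≤ x := norm_nonneg _
  have hD : 0 ≤ D := norm_nonneg _
  rw [le_div_iff₀ hg]
  change (lam k - lam l) * (m - (U * Uᵀ * (W * Wᵀ)).trace)
      ≤ (M * (U * Uᵀ - W * Wᵀ)).trace at h1
  have h6 : x * (x * (lam k - lam l)) ≤ x * (2 * D) := by
    nlinarith
  rcases hx.eq_or_lt with h0 | h0
  · rw [← h0]; simpa using hD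
  · exact le_of_mul_le_mul_left h6 h0

end spectral

/-! ### Stability of the sample covariance matrix -/

theorem frobenius_norm_vecMulVec {p q : ℕ} (u : EuclideanSpace ℝ (Fin p))
    (v : EuclideanSpace ℝ (Fin q)) : ‖Matrix.vecMulVec u.ofLp v.ofLp‖ = ‖u‖ * ‖v‖ := by
  have h : ‖Matrix.vecMulVec u.ofLp v.ofLp‖ ^ 2 = (‖u‖ * ‖v‖) ^ 2 := by
    rw [frobenius_norm_sq, mul_pow, EuclideanSpace.real_norm_sq_eq,
      EuclideanSpace.real_norm_sq_eq, Finset.sum_mul_sum]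
    simp [Matrix.vecMulVec_apply, mul_pow]
  exact (pow_left_inj₀ (norm_nonneg _) (by positivity) two_ne_zero).1 h

/-- The positive semidefinite matrices `u uᵀ` and `v vᵀ` have a nonnegative inner product, so the
squared norm of their difference is at most the sum of their squared norms. -/
theorem frobenius_norm_sq_vecMulVec_sub_le {d : ℕ} (u v : EuclideanSpace ℝ (Fin d)) :
    ‖Matrix.vecMulVec u.ofLp u.ofLp - Matrix.vecMulVec v.ofLp v.ofLp‖ ^ 2
      ≤ (‖u‖ ^ 2) ^ 2 + (‖v‖ ^ 2) ^ 2 := by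
  have h : ‖Matrix.vecMulVec u.ofLp u.ofLp - Matrix.vecMulVec v.ofLp v.ofLp‖ ^ 2
      = (‖u‖ ^ 2) ^ 2 + (‖v‖ ^ 2) ^ 2 - 2 * (∑ i, u i * v i) ^ 2 := by
    rw [frobenius_norm_sq, EuclideanSpace.real_norm_sq_eq, EuclideanSpace.real_norm_sq_eq,
      sq (∑ i, u i ^ 2), sq (∑ i, v i ^ 2), sq (∑ i, u i * v i), Finset.sum_mul_sum,
      Finset.sum_mul_sum, Finset.sum_mul_sum, Finset.mul_sum, ← Finset.sum_add_distrib,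
      ← Finset.sum_sub_distrib]
    refine Finset.sum_congr rfl fun i _ => ?_
    rw [Finset.mul_sum, ← Finset.sum_add_distrib, ← Finset.sum_sub_distrib]
    refine Finset.sum_congr rfl fun j _ => ?_
    simp only [Matrix.sub_apply, Matrix.vecMulVec_apply]
    ring
  rw [h]
  linarith [sq_nonneg (∑ i, u i * v i)]

section sample

variable {d n : ℕ}

theorem sampleCovMatrix_apply (hn : n ≠ 0) (x : Fin n → EuclideanSpace ℝ (Fin d)) (i j : Fin d) :
    sampleCovMatrix x i j = 1 / ((n : ℝ) - 1) *
      (∑ k, x k i * x k j - 1 / (n : ℝ) * ((∑ k, x k i) * ∑ k, x k j)) := by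
  have hn' : (n : ℝ) ≠ 0 := Nat.cast_ne_zero.2 hn
  simp only [sampleCovMatrix, Matrix.smul_apply, Matrix.mul_apply, Matrix.transpose_apply,
    centeredData, Matrix.of_apply, smul_eq_mul]
  congr 1
  set a := ∑ k, x k i
  set b := ∑ k, x k j
  have : ∀ k, (x k i - 1 / (n : ℝ) * a) * (x k j - 1 / (n : ℝ) * b)
      = x k i * x k j - 1 / (n : ℝ) * b * x k i - 1 / (n : ℝ) * a * x k j
        + (1 / (n : ℝ) * a) * (1 / (n : ℝ) * b) := fun k => by ring
  simp_rw [this]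
  rw [Finset.sum_add_distrib, Finset.sum_sub_distrib, Finset.sum_sub_distrib, ← Finset.mul_sum,
    ← Finset.mul_sum]
  change _ - _ * a - _ * b + _ = _
  simp
  field_simp
  ring

/-- The effect of replacing the sample point `x k` by `b`, in terms of the mean `m` of the remaining
sample points. -/
theorem sampleCovMatrix_update_sub (hn : 2 ≤ n) (x : Fin n → EuclideanSpace ℝ (Fin d)) (k : Fin n)
    (b m : EuclideanSpace ℝ (Fin d))
    (hm : m = (1 / ((n : ℝ) - 1)) • ∑ l ∈ Finset.univ.erase k, x l) :
    sampleCovMatrix (Function.update x k b) - sampleCovMatrix x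
      = (1 / (n : ℝ)) • (Matrix.vecMulVec (b - m).ofLp (b - m).ofLp
          - Matrix.vecMulVec (x k - m).ofLp (x k - m).ofLp) := by
  have hn0 : n ≠ 0 := by omega
  have hn' : (n : ℝ) ≠ 0 := Nat.cast_ne_zero.2 hn0
  have hn1 : (n : ℝ) - 1 ≠ 0 := by
    have : (2 : ℝ) ≤ n := by exact_mod_cast hn
    linarith
  have h1 : ∀ F : EuclideanSpace ℝ (Fin d) → ℝ,
      ∑ l, F (x l) = F (x k) + ∑ l ∈ Finset.univ.erase k, F (x l) := fun F =>
    (Finset.add_sum_erase _ _ (Finset.mem_univ k)).symm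
  have h2 : ∀ F : EuclideanSpace ℝ (Fin d) → ℝ,
      ∑ l, F (Function.update x k b l) = F b + ∑ l ∈ Finset.univ.erase k, F (x l) := fun F => by
    rw [← Finset.add_sum_erase _ _ (Finset.mem_univ k), Function.update_self]
    congr 1
    refine Finset.sum_congr rfl fun l hl => ?_
    rw [Function.update_of_ne (Finset.ne_of_mem_erase hl)]
  have hmi : ∀ i, m i = 1 / ((n : ℝ) - 1) * ∑ l ∈ Finset.univ.erase k, x l i := fun i => by
    simp [hm]
  ext i j
  rw [Matrix.sub_apply, sampleCovMatrix_apply hn0, sampleCovMatrix_apply hn0,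
    h1 fun y => y i * y j, h1 fun y => y i, h1 fun y => y j,
    h2 fun y => y i * y j, h2 fun y => y i, h2 fun y => y j]
  simp only [Matrix.smul_apply, Matrix.sub_apply, Matrix.vecMulVec_apply, PiLp.sub_apply, hmi,
    smul_eq_mul]
  field_simp
  ring

theorem norm_sampleCovMatrix_update_sub_le (hn : 2 ≤ n) {x : Fin n → EuclideanSpace ℝ (Fin d)}
    {k : Fin n} {b : EuclideanSpace ℝ (Fin d)} {B : ℝ} (hx : ∀ l, ‖x l‖ ^ 2 ≤ B)
    (hb : ‖b‖ ^ 2 ≤ B) :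
    ‖sampleCovMatrix (Function.update x k b) - sampleCovMatrix x‖ ≤ 4 * √2 * B / n := by
  have hB : 0 ≤ B := (sq_nonneg _).trans hb
  have hn2 : (2 : ℝ) ≤ n := by exact_mod_cast hn
  set m := (1 / ((n : ℝ) - 1)) • ∑ l ∈ Finset.univ.erase k, x l with hm
  have hm' : ‖m‖ ≤ √B := by
    have h1 : ‖∑ l ∈ Finset.univ.erase k, x l‖ ≤ ((n : ℝ) - 1) * √B := by
      refine (norm_sum_le_of_le _ fun l _ => Real.le_sqrt_of_sq_le (hx l)).trans ?_
      rw [Finset.sum_const, Finset.card_erase_of_mem (Finset.mem_univ k), Finset.card_univ,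
        Fintype.card_fin, nsmul_eq_mul, Nat.cast_sub (by omega)]
      simp
    rw [hm, norm_smul, Real.norm_of_nonneg (by apply one_div_nonneg.2; linarith), one_div,
      inv_mul_le_iff₀ (by linarith)]
    exact h1
  have hdiff : ∀ u : EuclideanSpace ℝ (Fin d), ‖u‖ ^ 2 ≤ B → ‖u - m‖ ^ 2 ≤ 4 * B := by
    intro u hu
    have h1 : ‖u - m‖ ≤ 2 * √B := by
      linarith [norm_sub_le u m, Real.le_sqrt_of_sq_le hu]
    calc ‖u - m‖ ^ 2 ≤ (2 * √B) ^ 2 := by gcongr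
      _ = 4 * B := by rw [mul_pow, Real.sq_sqrt hB]; norm_num
  rw [sampleCovMatrix_update_sub hn x k b m hm, norm_smul, Real.norm_of_nonneg (by positivity),
    one_div, inv_mul_eq_div]
  gcongr
  refine le_of_sq_le_sq ((frobenius_norm_sq_vecMulVec_sub_le _ _).trans ?_) (by positivity)
  have h1 := pow_le_pow_left₀ (sq_nonneg _) (hdiff b hb) 2
  have h2 := pow_le_pow_left₀ (sq_nonneg _) (hdiff (x k) (hx k)) 2
  have h3 : (4 * √2 * B) ^ 2 = 32 * B ^ 2 := by
    rw [mul_pow, mul_pow, Real.sq_sqrt (by norm_num)]; ring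
  rw [h3]
  linarith

end sample

/-! ### Mean error of the sample covariance matrix -/

section mean

variable {α : Type*} [MeasurableSpace α] {μ : Measure α} [IsProbabilityMeasure μ]

theorem integral_sq_mean_sub_le {n : ℕ} (hn : n ≠ 0) {φ : α → ℝ} (hφ : MemLp φ 2 μ) :
    ∫ x : Fin n → α, ((1 / n : ℝ) * ∑ k, φ (x k) - ∫ a, φ a ∂μ) ^ 2 ∂(Measure.pi fun _ => μ)
      ≤ (∫ a, φ a ^ 2 ∂μ) / n := by
  have hn' : (n : ℝ) ≠ 0 := Nat.cast_ne_zero.2 hn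
  have hmp := fun k : Fin n => measurePreserving_eval (fun _ : Fin n => μ) k
  have hk : ∀ k : Fin n, MemLp (fun x : Fin n → α => φ (x k)) 2 (Measure.pi fun _ => μ) :=
    fun k => hφ.comp_measurePreserving (hmp k)
  have hint : ∀ k : Fin n, ∫ x : Fin n → α, φ (x k) ∂(Measure.pi fun _ => μ) = ∫ a, φ a ∂μ :=
    fun k => by
      have h := integral_map (f := φ) (hmp k).measurable.aemeasurable
        (by rw [(hmp k).map_eq]; exact hφ.1)
      rw [(hmp k).map_eq] at h
      exact h.symm
  have hsum : MemLp (∑ k : Fin n, fun x : Fin n → α => φ (x k)) 2 (Measure.pi fun _ => μ) :=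
    memLp_finsetSum' _ fun k _ => hk k
  have hmean : ∫ x : Fin n → α, (∑ k : Fin n, fun x : Fin n → α => φ (x k)) x
      ∂(Measure.pi fun _ => μ) = n * ∫ a, φ a ∂μ := by
    simp only [Finset.sum_apply]
    rw [integral_finsetSum _ fun k _ => (hk k).integrable (by norm_num)]
    simp [hint]
  have hvar := variance_sum_pi (μ := fun _ : Fin n => μ) (X := fun _ => φ) fun _ => hφ
  rw [variance_eq_integral hsum.aemeasurable, hmean] at hvar
  have hle : Var[φ; μ] ≤ ∫ a, φ a ^ 2 ∂μ := variance_le_expectation_sq hφ.1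
  have heq : ∀ x : Fin n → α, ((1 / n : ℝ) * ∑ k, φ (x k) - ∫ a, φ a ∂μ) ^ 2
      = (1 / n ^ 2 : ℝ) * ((∑ k : Fin n, fun x : Fin n → α => φ (x k)) x - n * ∫ a, φ a ∂μ) ^ 2 :=
    fun x => by
      rw [Finset.sum_apply]
      field_simp
  simp_rw [heq]
  rw [integral_const_mul, hvar, Finset.sum_const, Finset.card_univ, Fintype.card_fin, nsmul_eq_mul]
  calc 1 / (n : ℝ) ^ 2 * (n * Var[φ; μ]) = Var[φ; μ] / n := by field_simp
    _ ≤ _ := by gcongr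

/-- The mean distance between the sample mean of a bounded random vector `(φ i)` and its expectation
is of order `1 / √n`. -/
theorem integral_sqrt_sum_sq_mean_sub_le {n : ℕ} (hn : n ≠ 0) {ι : Type*} [Fintype ι]
    {φ : ι → α → ℝ} (hφ : ∀ i, Measurable (φ i)) {K : ℝ} (hK : ∀ a, ∑ i, φ i a ^ 2 ≤ K) :
    Integrable (fun x : Fin n → α => √(∑ i, ((1 / n : ℝ) * ∑ k, φ i (x k) - ∫ a, φ i a ∂μ) ^ 2))
        (Measure.pi fun _ => μ) ∧
      ∫ x : Fin n → α, √(∑ i, ((1 / n : ℝ) * ∑ k, φ i (x k) - ∫ a, φ i a ∂μ) ^ 2)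
        ∂(Measure.pi fun _ => μ) ≤ √(K / n) := by
  have hφ2 : ∀ i, MemLp (φ i) 2 μ := fun i =>
    MemLp.of_bound (hφ i).aestronglyMeasurable √K (ae_of_all _ fun a => by
      refine Real.le_sqrt_of_sq_le ?_
      rw [Real.norm_eq_abs, sq_abs]
      exact (Finset.single_le_sum (f := fun i => φ i a ^ 2) (fun i _ => sq_nonneg _)
        (Finset.mem_univ i)).trans (hK a))
  have hi2 : ∀ i, MemLp (fun x : Fin n → α => (1 / n : ℝ) * ∑ k, φ i (x k) - ∫ a, φ i a ∂μ) 2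
      (Measure.pi fun _ => μ) := fun i =>
    ((memLp_finsetSum _ fun k _ => (hφ2 i).comp_measurePreserving
      (measurePreserving_eval (fun _ : Fin n => μ) k)).const_mul _).sub (memLp_const _)
  have hS : Integrable (fun x : Fin n → α =>
      ∑ i, ((1 / n : ℝ) * ∑ k, φ i (x k) - ∫ a, φ i a ∂μ) ^ 2) (Measure.pi fun _ => μ) :=
    integrable_finsetSum _ fun i _ => (hi2 i).integrable_sq
  have hR : MemLp (fun x : Fin n → α =>
      √(∑ i, ((1 / n : ℝ) * ∑ k, φ i (x k) - ∫ a, φ i a ∂μ) ^ 2)) 2 (Measure.pi fun _ => μ) := by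
    rw [memLp_two_iff_integrable_sq]
    · simp_rw [Real.sq_sqrt (Finset.sum_nonneg fun i _ => sq_nonneg _)]
      exact hS
    · exact hS.1.aemeasurable.sqrt.aestronglyMeasurable
  refine ⟨hR.integrable (by norm_num), Real.le_sqrt_of_sq_le ?_⟩
  have hjensen := variance_nonneg (fun x : Fin n → α =>
      √(∑ i, ((1 / n : ℝ) * ∑ k, φ i (x k) - ∫ a, φ i a ∂μ) ^ 2)) (Measure.pi fun _ => μ)
  rw [variance_eq_sub hR, sub_nonneg] at hjensen
  refine hjensen.trans ?_
  simp_rw [Pi.pow_apply, Real.sq_sqrt (Finset.sum_nonneg fun i _ => sq_nonneg _)]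
  rw [integral_finsetSum _ fun i _ => (hi2 i).integrable_sq]
  calc _ ≤ ∑ i, (∫ a, φ i a ^ 2 ∂μ) / n :=
        Finset.sum_le_sum fun i _ => integral_sq_mean_sub_le hn (hφ2 i)
    _ = (∫ a, ∑ i, φ i a ^ 2 ∂μ) / n := by
        rw [← Finset.sum_div, integral_finsetSum _ fun i _ => (hφ2 i).integrable_sq]
    _ ≤ K / n := by
        gcongr
        have := integral_mono (μ := μ) (integrable_finsetSum _ fun i _ => (hφ2 i).integrable_sq)
          (integrable_const K) hK
        simpa using this

end mean

theorem norm_sampleMean_le {d n : ℕ} (hn : n ≠ 0) {x : Fin n → EuclideanSpace ℝ (Fin d)} {B : ℝ}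
    (hx : ∀ l, ‖x l‖ ^ 2 ≤ B) : ‖(1 / n : ℝ) • ∑ k, x k‖ ≤ √B := by
  have hn' : (0 : ℝ) < n := by positivity
  have h1 : ‖∑ k, x k‖ ≤ n * √B := by
    refine (norm_sum_le_of_le _ fun l _ => Real.le_sqrt_of_sq_le (hx l)).trans ?_
    simp
  rw [norm_smul, Real.norm_of_nonneg (by positivity), one_div, inv_mul_le_iff₀ hn']
  exact h1

theorem norm_sampleCovMatrix_le {d n : ℕ} (hn : 2 ≤ n) {x : Fin n → EuclideanSpace ℝ (Fin d)}
    {B : ℝ} (hx : ∀ l, ‖x l‖ ^ 2 ≤ B) : ‖sampleCovMatrix x‖ ≤ 2 * B * n / (n - 1) := by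
  have hn0 : n ≠ 0 := by omega
  have hn2 : (2 : ℝ) ≤ n := by exact_mod_cast hn
  have hB : 0 ≤ B := (sq_nonneg _).trans (hx ⟨0, by omega⟩)
  set w := (1 / n : ℝ) • ∑ k, x k with hw
  have hw' : ‖w‖ ≤ √B := norm_sampleMean_le hn0 hx
  have hT : sampleCovMatrix x
      = (1 / ((n : ℝ) - 1)) • ∑ k, Matrix.vecMulVec (x k).ofLp (x k - w).ofLp := by
    ext i j
    rw [sampleCovMatrix_apply hn0]
    have hwj : w j = (1 / n : ℝ) * ∑ k, x k j := by simp [hw]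
    simp only [Matrix.smul_apply, Matrix.sum_apply, Matrix.vecMulVec_apply, PiLp.sub_apply, hwj,
      smul_eq_mul, mul_sub, Finset.sum_sub_distrib]
    rw [← Finset.sum_mul]
    ring
  rw [hT, norm_smul, Real.norm_of_nonneg (by apply one_div_nonneg.2; linarith), one_div,
    inv_mul_eq_div]
  have : (0 : ℝ) < n - 1 := by linarith
  gcongr
  refine (norm_sum_le_of_le (n := fun _ => 2 * B) _ fun k _ => ?_).trans ?_
  · rw [frobenius_norm_vecMulVec]
    have h1 : ‖x k‖ ≤ √B := Real.le_sqrt_of_sq_le (hx k)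
    calc ‖x k‖ * ‖x k - w‖ ≤ √B * (√B + √B) := by
          gcongr
          exact (norm_sub_le _ _).trans (add_le_add h1 hw')
      _ = 2 * B := by rw [← two_mul, mul_left_comm, Real.mul_self_sqrt hB]
  · simp [mul_comm]

section concentration

variable {α : Type*} [MeasurableSpace α] {μ : Measure α} [IsProbabilityMeasure μ] {d n : ℕ}
  {z : α → EuclideanSpace ℝ (Fin d)} {B : ℝ}

theorem measurable_norm_sampleCovMatrix_sub (hz : Measurable z) (C : Matrix (Fin d) (Fin d) ℝ) :
    Measurable fun x : Fin n → α => ‖sampleCovMatrix (fun k => z (x k)) - C‖ := by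
  simp_rw [frobenius_norm_eq_sqrt]
  simp only [sampleCovMatrix, centeredData, Matrix.sub_apply, Matrix.smul_apply, Matrix.mul_apply,
    Matrix.transpose_apply, Matrix.of_apply, smul_eq_mul]
  fun_prop

theorem memLp_coord (hz : Measurable z) (hB : ∀ a, ‖z a‖ ^ 2 ≤ B) (i : Fin d) :
    MemLp (fun a => z a i) 2 μ :=
  MemLp.of_bound (by fun_prop) √B (ae_of_all _ fun a =>
    (PiLp.norm_apply_le (z a) i).trans (Real.le_sqrt_of_sq_le (hB a)))

theorem covMatrix_map_apply (hz : Measurable z) (hB : ∀ a, ‖z a‖ ^ 2 ≤ B) (i j : Fin d) :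
    covMatrix (μ.map z) i j
      = ∫ a, z a i * z a j ∂μ - (∫ a, z a i ∂μ) * ∫ a, z a j ∂μ := by
  rw [covMatrix, Matrix.of_apply, covariance_map_fun (by fun_prop) (by fun_prop) (by fun_prop),
    covariance_eq_sub (memLp_coord hz hB i) (memLp_coord hz hB j)]
  rfl

/-- Comparison of the sample covariance matrix with the covariance matrix through the errors of the
empirical second and first moments; the last term accounts for the normalization by `n - 1` in place
of `n`. -/
theorem norm_sampleCovMatrix_sub_covMatrix_le (hz : Measurable z) (hB : ∀ a, ‖z a‖ ^ 2 ≤ B)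
    (hn : 2 ≤ n) (x : Fin n → α) :
    ‖sampleCovMatrix (fun k => z (x k)) - covMatrix (μ.map z)‖
      ≤ √(∑ p : Fin d × Fin d, ((1 / n : ℝ) * ∑ k, z (x k) p.1 * z (x k) p.2
            - ∫ a, z a p.1 * z a p.2 ∂μ) ^ 2)
        + 2 * √B * √(∑ i, ((1 / n : ℝ) * ∑ k, z (x k) i - ∫ a, z a i ∂μ) ^ 2)
        + 2 * B / (n - 1) := by
  have hn0 : n ≠ 0 := by omega
  have hn2 : (2 : ℝ) ≤ n := by exact_mod_cast hn
  have hn1 : (n : ℝ) - 1 ≠ 0 := by linarith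
  set T := sampleCovMatrix fun k => z (x k) with hT
  set w := (1 / n : ℝ) • ∑ k, z (x k) with hw
  set m := ∫ a, z a ∂μ with hm
  have hmi : ∀ i, m i = ∫ a, z a i ∂μ := fun i =>
    eval_integral_piLp (fun i => (memLp_coord hz hB i).integrable (by norm_num)) i
  have hwi : ∀ i, w i = (1 / n : ℝ) * ∑ k, z (x k) i := fun i => by simp [hw]
  have hm' : ‖m‖ ≤ √B := by
    have := norm_integral_le_of_norm_le_const (μ := μ) (f := z) (C := √B)
      (ae_of_all _ fun a => Real.le_sqrt_of_sq_le (hB a))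
    simpa using this
  have hw' : ‖w‖ ≤ √B := norm_sampleMean_le hn0 fun k => hB (x k)
  set A : Matrix (Fin d) (Fin d) ℝ := Matrix.of fun i j =>
    (1 / n : ℝ) * ∑ k, z (x k) i * z (x k) j - ∫ a, z a i * z a j ∂μ with hA
  have hAn : ‖A‖ = √(∑ p : Fin d × Fin d, ((1 / n : ℝ) * ∑ k, z (x k) p.1 * z (x k) p.2
            - ∫ a, z a p.1 * z a p.2 ∂μ) ^ 2) := by
    rw [frobenius_norm_eq_sqrt, Fintype.sum_prod_type]
    rfl
  have hwm : ‖w - m‖ = √(∑ i, ((1 / n : ℝ) * ∑ k, z (x k) i - ∫ a, z a i ∂μ) ^ 2) := by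
    rw [EuclideanSpace.norm_eq]
    simp [hwi, hmi]
  -- `T = n / (n - 1) * T₀` with `T₀ = A + M - w wᵀ`, where `M` is the matrix of second moments;
  -- hence `T = T₀ + T / n`, and `w wᵀ - m mᵀ` is split in the usual way.
  have hdecomp : T - covMatrix (μ.map z)
      = A - (Matrix.vecMulVec w.ofLp (w - m).ofLp + Matrix.vecMulVec (w - m).ofLp m.ofLp)
        + (1 / n : ℝ) • T := by
    ext i j
    simp only [Matrix.sub_apply, Matrix.add_apply, Matrix.smul_apply, Matrix.vecMulVec_apply,
      PiLp.sub_apply, covMatrix_map_apply hz hB, hT, sampleCovMatrix_apply hn0, hA, Matrix.of_apply,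
      hwi, hmi, smul_eq_mul]
    field_simp
    ring
  rw [hdecomp, ← hAn, ← hwm]
  have h1 : ‖(1 / n : ℝ) • T‖ ≤ 2 * B / (n - 1) := by
    rw [norm_smul, Real.norm_of_nonneg (by positivity), one_div, inv_mul_le_iff₀ (by positivity)]
    refine (norm_sampleCovMatrix_le hn fun k => hB (x k)).trans (le_of_eq ?_)
    ring
  have h2 : ‖Matrix.vecMulVec w.ofLp (w - m).ofLp + Matrix.vecMulVec (w - m).ofLp m.ofLp‖
      ≤ 2 * √B * ‖w - m‖ := by
    refine (norm_add_le _ _).trans ?_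
    rw [frobenius_norm_vecMulVec, frobenius_norm_vecMulVec]
    nlinarith [norm_nonneg (w - m)]
  linarith [norm_add_le (A - (Matrix.vecMulVec w.ofLp (w - m).ofLp
    + Matrix.vecMulVec (w - m).ofLp m.ofLp)) ((1 / n : ℝ) • T), norm_sub_le A
    (Matrix.vecMulVec w.ofLp (w - m).ofLp + Matrix.vecMulVec (w - m).ofLp m.ofLp)]

theorem integral_norm_sampleCovMatrix_sub_le (hz : Measurable z) (hB : ∀ a, ‖z a‖ ^ 2 ≤ B)
    (hn : 3 ≤ n) :
    ∫ x : Fin n → α, ‖sampleCovMatrix (fun k => z (x k)) - covMatrix (μ.map z)‖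
      ∂(Measure.pi fun _ => μ) ≤ 4 * √2 * B / √n := by
  have hn0 : n ≠ 0 := by omega
  have hn3 : (3 : ℝ) ≤ n := by exact_mod_cast hn
  have hB0 : 0 ≤ B := by
    obtain ⟨a₀⟩ : Nonempty α := nonempty_of_isProbabilityMeasure μ
    exact (sq_nonneg _).trans (hB a₀)
  have hcoord : ∀ i, Measurable fun a => z a i := fun i => by fun_prop
  have hprod : ∀ p : Fin d × Fin d, Measurable fun a => z a p.1 * z a p.2 :=
    fun p => (hcoord p.1).mul (hcoord p.2)
  obtain ⟨hI1, hE1⟩ := integral_sqrt_sum_sq_mean_sub_le (μ := μ) hn0 (K := B ^ 2) hprod fun a => by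
    simp only [mul_pow, Fintype.sum_prod_type]
    rw [← Finset.sum_mul_sum, ← EuclideanSpace.real_norm_sq_eq, ← sq]
    exact pow_le_pow_left₀ (sq_nonneg _) (hB a) 2
  obtain ⟨hI2, hE2⟩ := integral_sqrt_sum_sq_mean_sub_le (μ := μ) hn0 (K := B) hcoord fun a => by
    rw [← EuclideanSpace.real_norm_sq_eq]
    exact hB a
  have hI2' := hI2.const_mul (2 * √B)
  have hmono := integral_mono_of_nonneg (ae_of_all _ fun x => norm_nonneg _)
    ((hI1.add hI2').add (integrable_const (2 * B / ((n : ℝ) - 1))))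
    (ae_of_all _ fun x => norm_sampleCovMatrix_sub_covMatrix_le (μ := μ) hz hB (by omega) x)
  refine hmono.trans ?_
  rw [integral_add' (hI1.add hI2') (integrable_const _), integral_add' hI1 hI2',
    integral_const_mul]
  have hs : (1.7 : ℝ) ≤ √n := Real.le_sqrt_of_sq_le (by norm_num; linarith)
  have hss : √(n : ℝ) ^ 2 = n := Real.sq_sqrt (by positivity)
  have h1 : √(B ^ 2 / n) = B / √n := by rw [Real.sqrt_div (by positivity), Real.sqrt_sq hB0]
  have h2 : 2 * √B * √(B / n) = 2 * B / √n := by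
    rw [Real.sqrt_div hB0, mul_div_assoc', mul_assoc, Real.mul_self_sqrt hB0]
  have h3 : 2 * B / ((n : ℝ) - 1) ≤ 2 * B / √n := by
    gcongr
    nlinarith
  have h4 : (5 : ℝ) ≤ 4 * √2 := by
    have : (5 / 4 : ℝ) ≤ √2 := Real.le_sqrt_of_sq_le (by norm_num)
    linarith
  have h5 : 2 * √B * ∫ x : Fin n → α, √(∑ i, ((1 / n : ℝ) * ∑ k, z (x k) i - ∫ a, z a i ∂μ) ^ 2)
      ∂(Measure.pi fun _ => μ) ≤ 2 * √B * √(B / n) := by gcongr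
  rw [h1] at hE1
  rw [h2] at h5
  have h6 : 5 * B / √n ≤ 4 * √2 * B / √n := by gcongr
  have h7 : B / √n + 2 * B / √n + 2 * B / √n = 5 * B / √n := by ring
  simp only [integral_const, probReal_univ, one_smul]
  linarith

/-! ### Concentration of the sample covariance matrix -/

/-- With probability at least `1 - δ`, the sample covariance matrix of i.i.d. copies of the bounded
vector `z` is within `√2 E(δ)` of its covariance matrix in the Frobenius norm. -/
theorem measureReal_sqrt_two_mul_errE_lt_norm_le (hz : Measurable z) (hB : ∀ a, ‖z a‖ ^ 2 ≤ B)
    (hB0 : 0 < B) (hn : 3 ≤ n) {δ : ℝ} (hδ : 0 < δ) (hδ1 : δ ≤ 1) :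
    (Measure.pi fun _ : Fin n => μ).real
      {x | √2 * errE B n δ < ‖sampleCovMatrix (fun k => z (x k)) - covMatrix (μ.map z)‖} ≤ δ := by
  have hn' : (0 : ℝ) < n := by positivity
  set f : (Fin n → α) → ℝ :=
    fun x => ‖sampleCovMatrix (fun k => z (x k)) - covMatrix (μ.map z)‖
  obtain ⟨c, hc⟩ : ∃ c : NNReal, (c : ℝ) = 4 * √2 * B / n := ⟨⟨_, by positivity⟩, rfl⟩
  have hdiff : ∀ x k a, |f (Function.update x k a) - f x| ≤ c := fun x k a => by
    refine (abs_norm_sub_norm_le _ _).trans ?_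
    rw [hc, sub_sub_sub_cancel_right]
    have : (fun l => z (Function.update x k a l)) = Function.update (fun l => z (x l)) k (z a) := by
      ext1 l
      rcases eq_or_ne l k with rfl | h <;> simp [*]
    rw [this]
    exact norm_sampleCovMatrix_update_sub_le (by omega) (fun l => hB _) (hB a)
  have hsub := hasSubgaussianMGF_of_bounded_differences μ
    (measurable_norm_sampleCovMatrix_sub hz (covMatrix (μ.map z))) hdiff
  set L := Real.log (1 / δ) / 2 with hL
  have hL0 : 0 ≤ L := div_nonneg (Real.log_nonneg (by rw [le_div_iff₀ hδ]; linarith)) (by norm_num)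
  have ht : 0 ≤ 4 * √2 * B / √n * √L := by positivity
  have htail := hsub.measure_ge_le ht
  refine (measureReal_mono fun x hx => ?_).trans (htail.trans ?_)
  · have hx' : √2 * errE B n δ < f x := hx
    have hE := integral_norm_sampleCovMatrix_sub_le (μ := μ) hz hB hn
    have : √2 * errE B n δ = 4 * √2 * B / √n + 4 * √2 * B / √n * √L := by
      rw [errE, ← hL]; ring
    change _ ≤ f x - _
    linarith
  · have h1 : (4 * √2 * B / √n * √L) ^ 2 = 32 * B ^ 2 / n * L := by
      rw [mul_pow, div_pow, mul_pow, mul_pow, Real.sq_sqrt hL0, Real.sq_sqrt hn'.le,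
        Real.sq_sqrt (by norm_num)]
      ring
    have h2 : ((n * (c / 2) ^ 2 : NNReal) : ℝ) = 8 * B ^ 2 / n := by
      push_cast
      rw [hc, div_pow, div_pow, mul_pow, mul_pow, Real.sq_sqrt (by norm_num)]
      field_simp
      ring
    rw [h1, h2]
    have h3 : -(32 * B ^ 2 / n * L) / (2 * (8 * B ^ 2 / n)) = Real.log δ := by
      rw [hL, one_div, Real.log_inv]
      field_simp
      ring
    rw [h3, Real.exp_log hδ]

/-- Each eigenvalue of the covariance matrix of `z` is the variance of the projection of `z` to the
corresponding unit eigenvector. -/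
theorem IsOrderedEigensystem.eigenvalue_mem_Icc {V : Matrix (Fin d) (Fin d) ℝ} {lam : Fin d → ℝ}
    (hz : Measurable z) (hB : ∀ a, ‖z a‖ ^ 2 ≤ B)
    (hV : IsOrderedEigensystem (covMatrix (μ.map z)) lam V) (i : Fin d) :
    lam i ∈ Set.Icc 0 B := by
  have hY : ∀ a, MemLp (fun x => V a i * z x a) 2 μ := fun a => (memLp_coord hz hB a).const_mul _
  have hlam : lam i = Var[fun x => ∑ a, V a i * z x a; μ] := by
    rw [variance_fun_sum hY]
    have h : (Vᵀ * (covMatrix (μ.map z) * V)) i i = lam i := by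
      rw [hV.eigen, ← Matrix.mul_assoc, hV.orthonormal, Matrix.one_mul, Matrix.diagonal_apply_eq]
    rw [← h, Matrix.mul_apply]
    refine Finset.sum_congr rfl fun a _ => ?_
    rw [Matrix.mul_apply, Finset.mul_sum]
    refine Finset.sum_congr rfl fun b _ => ?_
    rw [covariance_const_mul_left, covariance_const_mul_right, covMatrix, Matrix.of_apply,
      covariance_map_fun (by fun_prop) (by fun_prop) (by fun_prop), Matrix.transpose_apply]
    ring
  have hnorm : ∑ a, V a i ^ 2 = 1 := by
    have := congrFun (congrFun hV.orthonormal i) i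
    simpa [Matrix.mul_apply, sq] using this
  refine ⟨hlam ▸ variance_nonneg _ _, hlam ▸ ?_⟩
  refine (variance_le_expectation_sq (by fun_prop)).trans ?_
  have h := integral_mono_of_nonneg (μ := μ) (g := fun _ => B)
    (f := fun x => (∑ a, V a i * z x a) ^ 2)
    (ae_of_all _ fun x => sq_nonneg _) (integrable_const B) (ae_of_all _ fun x => by
      refine (Finset.sum_mul_sq_le_sq_mul_sq _ _ _).trans ?_
      rw [hnorm, one_mul, ← EuclideanSpace.real_norm_sq_eq]
      exact hB x)
  simpa using h

end concentration

/-! ### Probabilistic bound for the eigenspaces -/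

theorem lemma2 {d d' n : ℕ} (hd'_pos : 1 ≤ d') (hd' : d' < d)
    (D : Measure (EuclideanSpace ℝ (Fin d))) [IsProbabilityMeasure D]
    (B : ℝ) (hB : ∀ᵐ x ∂D, ‖x‖ ^ 2 ≤ B)
    (lam : Fin d → ℝ) (V : Matrix (Fin d) (Fin d) ℝ)
    (hV : IsOrderedEigensystem (covMatrix D) lam V)
    (hlam : ∀ i j : Fin d, i < j → (j : ℕ) ≤ d' → lam j < lam i)
    (δ : ℝ) (hδ_pos : 0 < δ) (hδ_le : δ ≤ 1)
    (hn : (4 * B / (lam ⟨d' - 1, by omega⟩ - lam ⟨d', hd'⟩)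
        * (1 + √(Real.log (1 / δ) / 2))) ^ 2 ≤ (n : ℝ))
    {Ω : Type*} [MeasurableSpace Ω] (P : Measure Ω) [IsProbabilityMeasure P]
    (X : Fin n → Ω → EuclideanSpace ℝ (Fin d))
    (hX_law : ∀ k, HasLaw (X k) D P) (hX_indep : iIndepFun X P) :
    ∃ A : Set Ω, MeasurableSet A ∧ 1 - δ ≤ P.real A ∧
      ∀ ω ∈ A, ∀ (lam' : Fin d → ℝ) (V' : Matrix (Fin d) (Fin d) ℝ),
        IsOrderedEigensystem (sampleCovMatrix fun k => X k ω) lam' V' →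
        ‖firstCols hd'.le V * (firstCols hd'.le V)ᵀ
            - firstCols hd'.le V' * (firstCols hd'.le V')ᵀ‖
          ≤ 2 * √2 * errE B n δ
            * (√(d' : ℝ) / (lam ⟨d' - 1, by omega⟩ - lam ⟨d', hd'⟩)) := by
  have hBnn : 0 ≤ B := by
    obtain ⟨x, hx⟩ := hB.exists
    exact (sq_nonneg _).trans hx
  -- The bounded difference condition must hold everywhere, not just almost everywhere, so points
  -- outside the ball are moved to `0`; this does not change the law `D`.
  set S : Set (EuclideanSpace ℝ (Fin d)) := {x | ‖x‖ ^ 2 ≤ B} with hS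
  have hSm : MeasurableSet S := measurableSet_le (by fun_prop) measurable_const
  set z : EuclideanSpace ℝ (Fin d) → EuclideanSpace ℝ (Fin d) := S.indicator id with hz
  have hzm : Measurable z := measurable_id.indicator hSm
  have hzB : ∀ a, ‖z a‖ ^ 2 ≤ B := fun a => by
    by_cases ha : a ∈ S
    · rw [hz, Set.indicator_of_mem ha]; exact ha
    · rw [hz, Set.indicator_of_notMem ha]; simpa using hBnn
  have hzD : D.map z = D := by
    have : z =ᵐ[D] id := by
      filter_upwards [hB] with x hx
      exact Set.indicator_of_mem (s := S) hx id
    rw [Measure.map_congr this, Measure.map_id]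
  have hmem : ∀ i, lam i ∈ Set.Icc 0 B := fun i =>
    IsOrderedEigensystem.eigenvalue_mem_Icc (μ := D) hzm hzB (by rwa [hzD]) i
  have hgap : lam ⟨d', hd'⟩ < lam ⟨d' - 1, by omega⟩ :=
    hlam _ _ (by rw [Fin.lt_def]; simp; omega) le_rfl
  have hg : 0 < lam ⟨d' - 1, by omega⟩ - lam ⟨d', hd'⟩ := sub_pos.2 hgap
  have hgB : lam ⟨d' - 1, by omega⟩ - lam ⟨d', hd'⟩ ≤ B := by
    linarith [(hmem ⟨d' - 1, by omega⟩).2, (hmem ⟨d', hd'⟩).1]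
  have hBpos : 0 < B := hg.trans_le hgB
  -- The lower bound on `n` gives `16 ≤ n`, of which only `3 ≤ n` is needed.
  have hn3 : 3 ≤ n := by
    have h1 : 4 ≤ 4 * B / (lam ⟨d' - 1, by omega⟩ - lam ⟨d', hd'⟩) := by
      rw [le_div_iff₀ hg]; linarith
    have h2 : 4 ≤ 4 * B / (lam ⟨d' - 1, by omega⟩ - lam ⟨d', hd'⟩)
        * (1 + √(Real.log (1 / δ) / 2)) := by
      nlinarith [Real.sqrt_nonneg (Real.log (1 / δ) / 2)]
    have h3 : (3 : ℝ) ≤ n := by nlinarith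
    exact_mod_cast h3
  have hX : ∀ k, AEMeasurable (X k) P := fun k => (hX_law k).aemeasurable
  have hjoint : P.map (fun ω k => X k ω) = Measure.pi fun _ => D := by
    rw [(iIndepFun_iff_map_fun_eq_pi_map hX).1 hX_indep]
    congr 1
    funext k
    exact (hX_law k).map_eq
  set bad : Set (Fin n → EuclideanSpace ℝ (Fin d)) :=
    {x | √2 * errE B n δ < ‖sampleCovMatrix (fun k => z (x k)) - covMatrix D‖} with hbad
  have hbadm : MeasurableSet bad :=
    measurableSet_lt measurable_const (measurable_norm_sampleCovMatrix_sub hzm _)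
  have hbadP : P.real {ω | (fun k => X k ω) ∈ bad} ≤ δ := by
    have h := measureReal_sqrt_two_mul_errE_lt_norm_le (μ := D) (n := n) hzm hzB hBpos hn3
      hδ_pos hδ_le
    rw [hzD, ← hjoint, map_measureReal_apply_of_aemeasurable (aemeasurable_pi_lambda _ hX) hbadm]
      at h
    exact h
  have hin : ∀ᵐ ω ∂P, ∀ k, X k ω ∈ S := by
    rw [ae_all_iff]
    intro k
    refine ae_of_ae_map (hX k) (p := fun x => x ∈ S) ?_
    rw [(hX_law k).map_eq]
    exact hB
  -- `N` is only null-measurable in general, as the `X k` are only almost everywhere measurable; a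
  -- measurable superset of the same measure replaces it.
  set N : Set Ω := {ω | (fun k => X k ω) ∈ bad} ∪ {ω | ¬ ∀ k, X k ω ∈ S} with hN
  have hNP : P.real N ≤ δ := by
    refine (measureReal_union_le _ _).trans ?_
    have : P.real {ω | ¬ ∀ k, X k ω ∈ S} = 0 := by
      rw [measureReal_def, ae_iff.1 hin, ENNReal.toReal_zero]
    linarith
  refine ⟨(toMeasurable P N)ᶜ, (measurableSet_toMeasurable P N).compl, ?_, ?_⟩
  · rw [probReal_compl_eq_one_sub (measurableSet_toMeasurable P N), measureReal_def,
      measure_toMeasurable, ← measureReal_def]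
    linarith
  · intro ω hω lam' V' hV'
    have hωN : ω ∉ N := fun h => hω (subset_toMeasurable P N h)
    simp only [hN, Set.mem_union, Set.mem_ofPred_eq, not_or, not_not] at hωN
    obtain ⟨hωb, hωS⟩ := hωN
    have hzX : (fun k => z (X k ω)) = fun k => X k ω :=
      funext fun k => Set.indicator_of_mem (hωS k) id
    rw [hbad, Set.mem_ofPred_eq, not_lt, hzX] at hωb
    refine (hV.frobenius_norm_sub_le hV' hd'.le (Nat.sub_add_cancel hd'_pos) rfl hgap).trans ?_
    have hE : 0 ≤ √2 * errE B n δ := (norm_nonneg _).trans hωb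
    have hd1 : 1 ≤ √(d' : ℝ) := Real.one_le_sqrt.2 (by exact_mod_cast hd'_pos)
    rw [mul_div_assoc']
    refine div_le_div_of_nonneg_right ?_ hg.le
    nlinarith
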